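/- Let $n\ge 0$ be an integer, write $[m]=\{1,2,\dots,m\}$ (empty if $m\le 0$), let $\mathbf{k}$ be a field, and let $S_n$ be the group of permutations of $[n]$, with product $(\pi\sigma)(i)=\pi(\sigma(i))$. For $\ell\in[n]$ define the element $$t_\ell=\operatorname{cyc}_{\ell}+\operatorname{cyc}_{\ell,\ell+1}+\operatorname{cyc}_{\ell,\ell+1,\ell+2}+\cdots+\operatorname{cyc}_{\ell,\ell+1,\dots,n}$$ of the group algebra $\mathbf{k}[S_n]$, where $\operatorname{cyc}_{\ell,\ell+1,\dots,j}$ is the cycle $\ell\mapsto\ell+1\mapsto\cdots\mapsto j\mapsto\ell$ (so $\operatorname{cyc}_\ell=\mathrm{id}$). For $x\in\mathbf{k}[S_n]$ let $R(x)$ be the $\mathbf{k}$-linear endomorphism $y\mapsto yx$ of $\mathbf{k}[S_n]$. A set of integers is called lacunar if it contains no two consecutive integers. For $I\subseteq[n]$ and $\ell\in[n]$ let $$m_{I,\ell}=\min\{x\in\{0\}\cup I\cup\{n+1\} : x\ge\ell\}-\ell ,\qquad I'=\{i\in[n-1] : i\notin I,\ i+1\notin I\}.$$ Let $f_0=0$,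 $f_1=1$, $f_m=f_{m-1}+f_{m-2}$ be the Fibonacci numbers, and let $Q_1,Q_2,\dots,Q_{f_{n+1}}$ be all the $f_{n+1}$ lacunar subsets of $[n-1]$, listed without repetition in any order in which the sums of their elements are weakly increasing. For $w\in S_n$ let $\operatorname{Des}w=\{i\in[n-1] : w(i)>w(i+1)\}$, and let the $Q$-index $\operatorname{Qind}w$ be the smallest $i\in[f_{n+1}]$ such that $Q_i'\subseteq\operatorname{Des}w$ (such an $i$ always exists). Let $\lambda_1,\dots,\lambda_n\in\mathbf{k}$. For each $i\in[f_{n+1}]$ let $\delta_i$ be the number of $w\in S_n$ with $\operatorname{Qind}w=i$, and let $$g_i=\sum_{\ell=1}^n\lambda_\ell\, m_{Q_i,\ell}\in\mathbf{k}.$$ Then for every $\kappa\in\mathbf{k}$, the algebraic multiplicity of $\kappa$ as an eigenvalue of $R(\lambda_1t_1+\lambda_2t_2+\cdots+\lambda_nt_n)$ (that is, the multiplicity of $\kappa$ as a root of the characteristic polynomial, which is $0$ if $\kappa$ is not an eigenvalue) equals $$\sum_{\substack{i\in[f_{n+1}]\\ g_i=\kappa}}\delta_i .$$ -/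

import Mathlib

/-! Conventions. Subsets of `[n] = {1, …, n}` are `Finset ℕ` and are numbered from `1`. The symmetric
group `S_n` is `Equiv.Perm (Fin n)`, where `a : Fin n` stands for the number `a + 1 ∈ [n]`; its
product is `(π * σ) i = π (σ i)`. -/

namespace OneSidedShuffle

/-- The somewhere-to-below shuffle
`t_ℓ = cyc_ℓ + cyc_{ℓ,ℓ+1} + ⋯ + cyc_{ℓ,ℓ+1,…,n}` in the group algebra `k[S_n]`. Here
`Fin.cycleIcc ℓ j` sends `ℓ ↦ ℓ+1 ↦ ⋯ ↦ j ↦ ℓ` and fixes everything else. -/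
noncomputable def t (k : Type*) [CommRing k] (n : ℕ) (l : Fin n) :
    MonoidAlgebra k (Equiv.Perm (Fin n)) :=
  ∑ j ∈ Finset.Ici l, MonoidAlgebra.of k (Equiv.Perm (Fin n)) (Fin.cycleIcc l j)

/-- Right multiplication `R(x) : y ↦ y * x` on `k[S_n]`. -/
noncomputable def R {k : Type*} [CommRing k] {n : ℕ}
    (x : MonoidAlgebra k (Equiv.Perm (Fin n))) :
    Module.End k (MonoidAlgebra k (Equiv.Perm (Fin n))) :=
  LinearMap.mulRight k x

/-- A set of integers is lacunar if it contains no two consecutive integers. -/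
def IsLacunar (I : Finset ℕ) : Prop := ∀ i ∈ I, i + 1 ∉ I

/-- The enclosure `{0} ∪ I ∪ {n + 1}` of `I ⊆ [n]`. -/
def enclosure (n : ℕ) (I : Finset ℕ) : Finset ℕ := {0} ∪ I ∪ {n + 1}

theorem enclosure_filter_nonempty (n : ℕ) (I : Finset ℕ) (l : Fin n) :
    {x ∈ enclosure n I | (l : ℕ) + 1 ≤ x}.Nonempty :=
  ⟨n + 1, by simp [enclosure]⟩

/-- `m_{I,ℓ}` = (smallest element of the enclosure of `I` that is `≥ ℓ`) `- ℓ`, where the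
number `ℓ ∈ [n]` is `l + 1`. -/
def m (n : ℕ) (I : Finset ℕ) (l : Fin n) : ℕ :=
  {x ∈ enclosure n I | (l : ℕ) + 1 ≤ x}.min' (enclosure_filter_nonempty n I l) - ((l : ℕ) + 1)

/-- The non-shadow `I' = [n-1] \ (I ∪ (I - 1))`: all `i ∈ [n-1]` with `i ∉ I` and `i + 1 ∉ I`. -/
def nonShadow (n : ℕ) (I : Finset ℕ) : Finset ℕ :=
  {i ∈ Finset.Icc 1 (n - 1) | i ∉ I ∧ i + 1 ∉ I}

/-- The descent set of `w`: all `i ∈ [n-1]` with `w(i) > w(i+1)`. The elements `a`, `b` of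
`Fin n` stand for the numbers `i` and `i + 1`. -/
def Des {n : ℕ} (w : Equiv.Perm (Fin n)) : Finset ℕ :=
  {i ∈ Finset.Icc 1 (n - 1) | ∃ a b : Fin n, (a : ℕ) + 1 = i ∧ (b : ℕ) + 1 = i + 1 ∧ w b < w a}

/-- A listing `Q_1, Q_2, …, Q_{f_{n+1}}` (without repetition) of all lacunar subsets of `[n-1]`
such that `sum Q_1 ≤ sum Q_2 ≤ ⋯`. The index `i : Fin f_{n+1}` stands for `i + 1`. -/
structure LacunarListing (n : ℕ) where
  Q : Fin (Nat.fib (n + 1)) → Finset ℕ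
  injective : Function.Injective Q
  mem_range_iff : ∀ I : Finset ℕ, I ∈ Set.range Q ↔ I ⊆ Finset.Icc 1 (n - 1) ∧ IsLacunar I
  sum_mono : Monotone fun i => ∑ x ∈ Q i, x

instance instDecidableIsLacunar (I : Finset ℕ) : Decidable (IsLacunar I) := by unfold IsLacunar; infer_instance

/-- The lacunar subsets of `[m]`. -/
def lacunarSubsets (m : ℕ) : Finset (Finset ℕ) := (Finset.Icc 1 m).powerset.filter IsLacunar

theorem card_lacunarSubsets : ∀ m, (lacunarSubsets m).card = Nat.fib (m + 2)
  | 0 => by decide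
  | 1 => by decide
  | m + 2 => by
    have h : lacunarSubsets (m + 2) = lacunarSubsets (m + 1) ∪ (lacunarSubsets m).image (insert (m + 2)) := by
      ext I
      simp only [lacunarSubsets, Finset.mem_union, Finset.mem_image, Finset.mem_filter, Finset.mem_powerset]
      constructor
      · rintro ⟨hs, hl⟩
        by_cases hm : m + 2 ∈ I
        · right
          refine ⟨I.erase (m + 2), ⟨?_, ?_⟩, Finset.insert_erase hm⟩
          · intro x hx
            have h1 := Finset.mem_erase.1 hx
            have h2 := Finset.mem_Icc.1 (hs h1.2)
            have h3 : x ≠ m + 1 := by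
              rintro rfl; exact hl _ h1.2 hm
            rw [Finset.mem_Icc]; omega
          · intro i hi hi'
            exact hl i (Finset.mem_of_mem_erase hi) (Finset.mem_of_mem_erase hi')
        · left
          refine ⟨fun x hx => ?_, hl⟩
          have h2 := Finset.mem_Icc.1 (hs hx)
          have h3 : x ≠ m + 2 := by rintro rfl; exact hm hx
          rw [Finset.mem_Icc]; omega
      · rintro (⟨hs, hl⟩ | ⟨J, ⟨hs, hl⟩, rfl⟩)
        · exact ⟨hs.trans (Finset.Icc_subset_Icc le_rfl (by omega)), hl⟩
        · refine ⟨?_, ?_⟩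
          · intro x hx
            rcases Finset.mem_insert.1 hx with rfl | hx
            · simp
            · have := Finset.mem_Icc.1 (hs hx); rw [Finset.mem_Icc]; omega
          · intro i hi hi'
            rcases Finset.mem_insert.1 hi with rfl | hi <;>
              rcases Finset.mem_insert.1 hi' with h | hi'
            · omega
            · have := Finset.mem_Icc.1 (hs hi'); omega
            · have := Finset.mem_Icc.1 (hs hi); omega
            · exact hl i hi hi'
    have hn : ∀ J ∈ lacunarSubsets m, m + 2 ∉ J := by
      intro J hJ hm
      have := Finset.mem_Icc.1 (Finset.mem_powerset.1 (Finset.mem_filter.1 hJ).1 hm); omega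
    rw [h, Finset.card_union_of_disjoint, Finset.card_image_of_injOn, card_lacunarSubsets (m + 1), card_lacunarSubsets m,
      Nat.fib_add_two (n := m + 2), add_comm]
    · intro J hJ K hK he
      rw [← Finset.erase_insert (hn J hJ), ← Finset.erase_insert (hn K hK)]
      exact congrArg (fun s => s.erase (m + 2)) he
    · rw [Finset.disjoint_left]
      intro I hI hI'
      obtain ⟨J, -, rfl⟩ := Finset.mem_image.1 hI'
      have := Finset.mem_Icc.1 (Finset.mem_powerset.1 (Finset.mem_filter.1 hI).1
        (Finset.mem_insert_self _ _)); omega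

/-- A listing of the lacunar subsets of `[n-1]` as above exists for every `n`. -/
theorem nonempty_lacunarListing (n : ℕ) : Nonempty (LacunarListing n) := by
  have hc : (lacunarSubsets (n - 1)).card = Nat.fib (n + 1) := by
    cases n with
    | zero => decide
    | succ n => exact card_lacunarSubsets n
  let e := ((lacunarSubsets (n - 1)).equivFinOfCardEq hc).symm
  let f : Fin (Nat.fib (n + 1)) → ℕ := fun i => ∑ x ∈ (e i : Finset ℕ), x
  refine ⟨⟨fun i => e (Tuple.sort f i), ?_, ?_, Tuple.monotone_sort f⟩⟩
  · exact Subtype.val_injective.comp (e.injective.comp (Tuple.sort f).injective)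
  · intro I
    have : I ⊆ Finset.Icc 1 (n - 1) ∧ IsLacunar I ↔ I ∈ lacunarSubsets (n - 1) := by simp [lacunarSubsets]
    rw [this]
    constructor
    · rintro ⟨i, rfl⟩; exact (e _).2
    · intro h
      exact ⟨(Tuple.sort f).symm (e.symm ⟨I, h⟩), by simp⟩

namespace LacunarListing

variable {n : ℕ} (L : LacunarListing n)

theorem exists_nonShadow_subset (w : Equiv.Perm (Fin n)) :
    (Finset.univ.filter fun i => nonShadow n (L.Q i) ⊆ Des w).Nonempty := by
  obtain ⟨i, hi⟩ := (L.mem_range_iff {j ∈ Finset.Icc 1 (n - 1) | j % 2 = (n - 1) % 2}).2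
    ⟨Finset.filter_subset _ _, fun i hi hi' => by
      simp only [Finset.mem_filter] at hi hi'; omega⟩
  refine ⟨i, ?_⟩
  simp only [Finset.mem_filter, Finset.mem_univ, true_and, hi]
  intro j hj
  simp only [nonShadow, Finset.mem_filter, Finset.mem_Icc] at hj
  omega

/-- The `Q`-index of `w`: the smallest `i` such that the non-shadow of `Q_i` is contained in the
descent set of `w`. -/
def Qind (w : Equiv.Perm (Fin n)) : Fin (Nat.fib (n + 1)) :=
  (Finset.univ.filter fun i => nonShadow n (L.Q i) ⊆ Des w).min' (L.exists_nonShadow_subset w)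

/-- `δ_i`: the number of permutations `w ∈ S_n` with `Q`-index `i`. -/
def delta (i : Fin (Nat.fib (n + 1))) : ℕ :=
  Fintype.card {w : Equiv.Perm (Fin n) // L.Qind w = i}

/-- `g_i = λ_1 m_{Q_i,1} + ⋯ + λ_n m_{Q_i,n}`. -/
def g {k : Type*} [CommRing k] (lam : Fin n → k) (i : Fin (Nat.fib (n + 1))) : k :=
  ∑ l : Fin n, lam l * (m n (L.Q i) l : k)

end LacunarListing

/-- The algebraic multiplicity of `κ` as an eigenvalue of an endomorphism `f` of a
finite-dimensional vector space: its multiplicity as a root of the characteristic polynomial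
(so it is `0` when `κ` is not an eigenvalue). -/
noncomputable def algMultiplicity {k V : Type*} [Field k] [AddCommGroup V] [Module k V]
    [Module.Finite k V] (f : Module.End k V) (κ : k) : ℕ :=
  (LinearMap.charpoly f).rootMultiplicity κ

end OneSidedShuffle

/-! The proof makes `R` of the combined shuffle triangular in a basis that does not depend on `lam`.
For a set `I`, let F(I) be the space of `q` with `q s_i = q` for all `i ∈ I'`. On F(I), every `t_l`
acts as the scalar `m_{I,l}` modulo the spaces F(K) of lacunar `K` with smaller sum
(`mul_t_sub_mem_lowerInvariants`): the cycles ending before the next element of `I` at or after `l`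
fix `q`, and the others, grouped between consecutive elements of `I`, send `q` into F(J) for a set
`J` of smaller sum. Such a `J` can be made lacunar without raising its sum or shrinking its shadow
(`exists_lacunar_nonShadow_subset`). The elements `a_w` are unitriangular for the lexicographic
order, so they form a basis, and F(I) is spanned by those with `I' ⊆ Des w`
(`rightInvariants_le_span`). Grouping the basis by `Qind` makes the matrix block triangular, with
block `i` equal to `g_i` times an identity matrix of size `δ_i`; the characteristic polynomial
follows. -/

namespace OneSidedShuffle

open Equiv

/-! ### Simple transpositions and cycles. -/

/-- The simple transposition `s_i` of `[n]`, which swaps the numbers `i` and `i + 1`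
(and the identity unless `1 ≤ i < n`). -/
def simpleSwap (n i : ℕ) : Perm (Fin n) :=
  if h : 1 ≤ i ∧ i < n then swap ⟨i - 1, by omega⟩ ⟨i, h.2⟩ else 1

theorem simpleSwap_apply {n i : ℕ} (h1 : 1 ≤ i) (h2 : i < n) (x : Fin n) :
    ((simpleSwap n i x : Fin n) : ℕ) =
      if (x : ℕ) + 1 = i then i else if (x : ℕ) = i then i - 1 else x := by
  rw [simpleSwap, dif_pos ⟨h1, h2⟩, swap_apply_def]
  simp only [Fin.ext_iff]
  split_ifs <;> first | rfl | omega

theorem simpleSwap_mul_self (n i : ℕ) : simpleSwap n i * simpleSwap n i = 1 := by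
  unfold simpleSwap
  split_ifs <;> simp

theorem simpleSwap_comm {n i j : ℕ} (h : i + 1 < j) :
    simpleSwap n i * simpleSwap n j = simpleSwap n j * simpleSwap n i := by
  by_cases hi : 1 ≤ i ∧ i < n
  · by_cases hj : 1 ≤ j ∧ j < n
    · ext x
      simp only [Perm.mul_apply, simpleSwap_apply hi.1 hi.2, simpleSwap_apply hj.1 hj.2]
      split_ifs <;> omega
    · simp [simpleSwap, hj]
  · simp [simpleSwap, hi]

theorem simpleSwap_braid {n i : ℕ} (h1 : 1 ≤ i) (h2 : i + 1 < n) :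
    simpleSwap n i * simpleSwap n (i + 1) * simpleSwap n i =
      simpleSwap n (i + 1) * simpleSwap n i * simpleSwap n (i + 1) := by
  set x : Fin n := ⟨i - 1, by omega⟩
  set y : Fin n := ⟨i, by omega⟩
  set z : Fin n := ⟨i + 1, h2⟩
  have hxy : x ≠ y := Fin.ne_of_val_ne (by simp only [x, y]; omega)
  have hyz : y ≠ z := Fin.ne_of_val_ne (by simp only [y, z]; omega)
  have hxz : x ≠ z := Fin.ne_of_val_ne (by simp only [x, z]; omega)
  have h3 : simpleSwap n i = swap x y := dif_pos ⟨h1, by omega⟩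
  have h4 : simpleSwap n (i + 1) = swap y z := dif_pos ⟨by omega, h2⟩
  rw [h3, h4, swap_mul_swap_mul_swap hxy hxz, swap_comm x y, swap_comm y z,
    swap_mul_swap_mul_swap hyz.symm hxz.symm, swap_comm]

/-- The cycle `l ↦ l + 1 ↦ ⋯ ↦ j ↦ l`, as the product `s_l s_{l+1} ⋯ s_{j-1}`. -/
def cyc (n l : ℕ) : ℕ → Perm (Fin n)
  | 0 => 1
  | j + 1 => if l ≤ j then cyc n l j * simpleSwap n j else 1

theorem cyc_of_le {n l j : ℕ} (h : j ≤ l) : cyc n l j = 1 := by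
  cases j with
  | zero => rfl
  | succ j => exact if_neg (by omega)

theorem cyc_succ {n l j : ℕ} (h : l ≤ j) : cyc n l (j + 1) = cyc n l j * simpleSwap n j :=
  if_pos h

theorem cyc_mul_cyc {n l p j : ℕ} (h1 : l ≤ p) (h2 : p ≤ j) :
    cyc n l p * cyc n p j = cyc n l j := by
  induction j, h2 using Nat.le_induction with
  | base => rw [cyc_of_le (le_refl p), mul_one]
  | succ j hj ih => rw [cyc_succ hj, cyc_succ (h1.trans hj), ← ih, mul_assoc]

theorem cyc_mul_simpleSwap_of_lt {n l j i : ℕ} (h : i + 1 < l) :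
    cyc n l j * simpleSwap n i = simpleSwap n i * cyc n l j := by
  rcases le_total j l with hj | hj
  · simp [cyc_of_le hj]
  induction j, hj using Nat.le_induction with
  | base => simp [cyc_of_le (le_refl l)]
  | succ j hj ih =>
    rw [cyc_succ hj, mul_assoc, ← simpleSwap_comm (by omega : i + 1 < j), ← mul_assoc, ih,
      mul_assoc]

theorem cyc_mul_simpleSwap_of_gt {n l j i : ℕ} (h : j < i) :
    cyc n l j * simpleSwap n i = simpleSwap n i * cyc n l j := by
  rcases le_total j l with hj | hj
  · simp [cyc_of_le hj]
  induction j, hj using Nat.le_induction with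
  | base => simp [cyc_of_le (le_refl l)]
  | succ j hj ih =>
    rw [cyc_succ hj, mul_assoc, simpleSwap_comm (by omega : j + 1 < i), ← mul_assoc,
      ih (by omega), mul_assoc]

/-- Conjugation by the cycle shifts `s_i` to `s_{i+1}`; the braid relation handles the shortest
cycle, and later factors commute with `s_i`. -/
theorem cyc_mul_simpleSwap_of_mem {n l j i : ℕ} (h0 : 1 ≤ l) (h1 : l ≤ i) (h2 : i + 1 < j)
    (h3 : j ≤ n) : cyc n l j * simpleSwap n i = simpleSwap n (i + 1) * cyc n l j := by
  induction j, (show i + 2 ≤ j from h2) using Nat.le_induction with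
  | base =>
    rw [cyc_succ (by omega), cyc_succ h1, mul_assoc, mul_assoc, ← mul_assoc (simpleSwap n i),
      simpleSwap_braid (by omega) (by omega), ← mul_assoc, ← mul_assoc,
      cyc_mul_simpleSwap_of_gt (by omega)]
    simp only [mul_assoc]
  | succ j hj ih =>
    rw [cyc_succ (by omega), mul_assoc, ← simpleSwap_comm (by omega : i + 1 < j), ← mul_assoc,
      ih (by omega) (by omega), mul_assoc]

theorem cyc_succ_mul_simpleSwap {n l i : ℕ} (h : l ≤ i) :
    cyc n l (i + 1) * simpleSwap n i = cyc n l i := by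
  rw [cyc_succ h, mul_assoc, simpleSwap_mul_self, mul_one]

theorem cyc_apply {n l j : ℕ} (h0 : 1 ≤ l) (h1 : l ≤ j) (h2 : j ≤ n) (x : Fin n) :
    ((cyc n l j x : Fin n) : ℕ) =
      if (x : ℕ) + 1 < l ∨ j < (x : ℕ) + 1 then (x : ℕ)
      else if (x : ℕ) + 1 = j then l - 1 else x + 1 := by
  induction j, h1 using Nat.le_induction generalizing x with
  | base =>
    rw [cyc_of_le le_rfl]
    simp only [Perm.coe_one, id_eq]
    split_ifs <;> omega
  | succ j hj ih =>
    rw [cyc_succ hj, Perm.mul_apply, ih (by omega), simpleSwap_apply (by omega) (by omega)]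
    split_ifs <;> omega

theorem cycleIcc_eq_cyc {n : ℕ} {l j : Fin n} (h : l ≤ j) :
    Fin.cycleIcc l j = cyc n (l + 1) (j + 1) := by
  have : NeZero n := ⟨by have := l.2; omega⟩
  have hl : (l : ℕ) ≤ j := h
  ext x
  rw [cyc_apply (by omega) (by omega) (by omega)]
  rcases lt_or_ge x l with hx | hx
  · rw [Fin.cycleIcc_of_lt hx, if_pos]
    have : (x : ℕ) < l := hx
    omega
  rcases lt_or_ge j x with hx' | hx'
  · rw [Fin.cycleIcc_of_gt hx', if_pos]
    have : (j : ℕ) < x := hx'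
    omega
  have h1 : (l : ℕ) ≤ x := hx
  have h2 : (x : ℕ) ≤ j := hx'
  rw [if_neg (by omega), Fin.cycleIcc_of_le_of_le hx hx']
  by_cases hxj : x = j
  · simp [hxj]
  · have h3 : (x : ℕ) ≠ j := fun h => hxj (Fin.ext h)
    rw [if_neg hxj, if_neg (by omega), Fin.val_add_one_of_lt' (by omega)]

theorem t_eq_sum (k : Type*) [CommRing k] (n : ℕ) (l : Fin n) :
    t k n l = ∑ j ∈ Finset.Ico ((l : ℕ) + 1) (n + 1), MonoidAlgebra.of k _ (cyc n (l + 1) j) := by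
  unfold t
  refine Finset.sum_bij (fun j _ => (j : ℕ) + 1) ?_ ?_ ?_ ?_
  · intro j hj
    have : l ≤ j := Finset.mem_Ici.1 hj
    rw [Fin.le_def] at this
    simp only [Finset.mem_Ico]
    omega
  · intro a _ b _ h
    exact Fin.ext (by omega)
  · intro b hb
    rw [Finset.mem_Ico] at hb
    exact ⟨⟨b - 1, by omega⟩, Finset.mem_Ici.2 (Fin.le_def.2 (by simp; omega)), by simp; omega⟩
  · intro j hj
    rw [cycleIcc_eq_cyc (Finset.mem_Ici.1 hj)]

/-! ### Shadows and reduction to lacunar sets. -/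

/-- An element `x` shadows `x - 1` and `x`. Lowering it loses only `x`, which lies outside `[n-1]`
or is still shadowed by `x + 1`. -/
theorem nonShadow_insert_pred_subset {n x : ℕ} {J : Finset ℕ} (h : n ≤ x ∨ x + 1 ∈ J) :
    nonShadow n (insert (x - 1) (J.erase x)) ⊆ nonShadow n J := by
  intro i hi
  simp only [nonShadow, Finset.mem_filter, Finset.mem_Icc, Finset.mem_insert, Finset.mem_erase,
    not_or, not_and] at hi ⊢
  refine ⟨hi.1, fun h1 => ?_, fun h1 => ?_⟩
  · by_cases hx : i = x
    · subst hx
      exact hi.2.2.2 (by omega) (h.resolve_left (by omega))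
    · exact hi.2.1.2 hx h1
  · by_cases hx : i + 1 = x
    · exact hi.2.1.1 (by omega)
    · exact hi.2.2.2 hx h1

/-- The shadow of any finite set is contained in the shadow of a lacunar subset of `[n-1]` whose
sum of elements is not larger. -/
theorem exists_lacunar_nonShadow_subset (n : ℕ) (J : Finset ℕ) :
    ∃ K ⊆ Finset.Icc 1 (n - 1), IsLacunar K ∧ ∑ x ∈ K, x ≤ ∑ x ∈ J, x ∧
      nonShadow n K ⊆ nonShadow n J := by
  -- The weight `x + 1` makes the measure drop also when `0`, which shadows nothing in `[n-1]`, is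
  -- deleted.
  induction hs : ∑ x ∈ J, (x + 1) using Nat.strong_induction_on generalizing J with
  | _ s ih =>
  by_cases h0 : 0 ∈ J
  · have h1 := Finset.add_sum_erase J (fun x => x + 1) h0
    have h2 := Finset.add_sum_erase J (fun x => x) h0
    obtain ⟨K, hK, hl, hsum, hsub⟩ := ih _ (by omega) (J.erase 0) rfl
    refine ⟨K, hK, hl, by omega, hsub.trans fun i hi => ?_⟩
    simp only [nonShadow, Finset.mem_filter, Finset.mem_Icc, Finset.mem_erase] at hi ⊢
    exact ⟨hi.1, fun h => hi.2.1 ⟨by omega, h⟩, fun h => hi.2.2 ⟨by omega, h⟩⟩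
  by_cases hx : ∃ x ∈ J, n ≤ x ∨ x + 1 ∈ J
  · obtain ⟨x, hxJ, hx⟩ := hx
    have hx0 : x ≠ 0 := fun h => h0 (h ▸ hxJ)
    have key : ∀ f : ℕ → ℕ, ∑ y ∈ insert (x - 1) (J.erase x), f y + f x ≤
        ∑ y ∈ J, f y + f (x - 1) := by
      intro f
      have h1 := Finset.add_sum_erase J f hxJ
      by_cases hm : x - 1 ∈ J.erase x
      · rw [Finset.insert_eq_of_mem hm]
        omega
      · rw [Finset.sum_insert hm]
        omega
    have k1 := key fun x => x + 1
    have k2 := key fun x => x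
    obtain ⟨K, hK, hl, hsum, hsub⟩ := ih _ (by omega) (insert (x - 1) (J.erase x)) rfl
    exact ⟨K, hK, hl, by omega, hsub.trans (nonShadow_insert_pred_subset hx)⟩
  · push Not at hx
    refine ⟨J, fun x hxJ => ?_, fun x hxJ => (hx x hxJ).2, le_rfl, subset_rfl⟩
    have := (hx x hxJ).1
    have : x ≠ 0 := fun h => h0 (h ▸ hxJ)
    rw [Finset.mem_Icc]
    omega

/-! ### The action of the shuffles on invariants. -/

section

/-- The elements `q` of `k[S_n]` with `q s_i = q` for all `i ∈ D`. -/
def rightInvariants (k : Type*) [CommRing k] (n : ℕ) (D : Finset ℕ) :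
    Submodule k (MonoidAlgebra k (Perm (Fin n))) where
  carrier := {q | ∀ i ∈ D, q * MonoidAlgebra.of k _ (simpleSwap n i) = q}
  zero_mem' := fun _ _ => zero_mul _
  add_mem' := fun ha hb i hi => by rw [add_mul, ha i hi, hb i hi]
  smul_mem' := fun c q hq i hi => by rw [smul_mul_assoc, hq i hi]

variable {k : Type*} [CommRing k] {n : ℕ}

theorem rightInvariants_anti {D E : Finset ℕ} (h : D ⊆ E) :
    rightInvariants k n E ≤ rightInvariants k n D :=
  fun _ hq i hi => hq i (h hi)

theorem mem_nonShadow {I : Finset ℕ} {i : ℕ} :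
    i ∈ nonShadow n I ↔ (1 ≤ i ∧ i ≤ n - 1) ∧ i ∉ I ∧ i + 1 ∉ I := by
  simp [nonShadow]

/-- The cycle is a product of `s_i` with `l ≤ i < j`, and all of these have `i ∈ I'` because `I`
misses `[l, j]`. -/
theorem mul_cyc_eq_self {I : Finset ℕ} {q : MonoidAlgebra k (Perm (Fin n))}
    (hq : q ∈ rightInvariants k n (nonShadow n I)) {l j : ℕ} (h0 : 1 ≤ l) (h1 : l ≤ j)
    (hj : j ≤ n) (hI : ∀ x ∈ I, l ≤ x → j < x) :
    q * MonoidAlgebra.of k _ (cyc n l j) = q := by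
  induction j, h1 using Nat.le_induction with
  | base => rw [cyc_of_le le_rfl, map_one, mul_one]
  | succ j hlj ih =>
    rw [cyc_succ hlj, map_mul, ← mul_assoc,
      ih (by omega) fun x hx hl => by have := hI x hx hl; omega]
    refine hq j (mem_nonShadow.2 ⟨by omega, fun h => ?_, fun h => ?_⟩)
    · have := hI _ h hlj
      omega
    · have := hI _ h (by omega)
      omega

/-- Decrease by one the elements of `I` that lie between `l` and `a`. -/
def lowerBetween (l a : ℕ) (I : Finset ℕ) : Finset ℕ :=
  I.image fun x => if l ≤ x ∧ x ≤ a then x - 1 else x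

theorem sum_lowerBetween_lt {l a : ℕ} {I : Finset ℕ} (ha : a ∈ I) (h0 : 1 ≤ a) (hl : l ≤ a) :
    ∑ x ∈ lowerBetween l a I, x < ∑ x ∈ I, x := by
  refine lt_of_le_of_lt
    (Finset.sum_image_le_of_nonneg (f := fun x => x) (fun _ _ => Nat.zero_le _)) ?_
  refine Finset.sum_lt_sum (fun x _ => ?_) ⟨a, ha, ?_⟩
  · split_ifs <;> omega
  · rw [if_pos ⟨hl, le_rfl⟩]
    omega

theorem pred_mem_lowerBetween {l a x : ℕ} {I : Finset ℕ} (hx : x ∈ I) (h1 : l ≤ x) (h2 : x ≤ a) :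
    x - 1 ∈ lowerBetween l a I :=
  Finset.mem_image.2 ⟨x, hx, if_pos ⟨h1, h2⟩⟩

theorem mem_lowerBetween_of_lt_or_gt {l a x : ℕ} {I : Finset ℕ} (hx : x ∈ I) (h : x < l ∨ a < x) :
    x ∈ lowerBetween l a I :=
  Finset.mem_image.2 ⟨x, hx, if_neg (by omega)⟩

theorem mul_cyc_mul_simpleSwap {q : MonoidAlgebra k (Perm (Fin n))} {l j i i' : ℕ}
    (h : cyc n l j * simpleSwap n i = simpleSwap n i' * cyc n l j)
    (hq : q * MonoidAlgebra.of k _ (simpleSwap n i') = q) :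
    q * MonoidAlgebra.of k _ (cyc n l j) * MonoidAlgebra.of k _ (simpleSwap n i) =
      q * MonoidAlgebra.of k _ (cyc n l j) := by
  rw [mul_assoc, ← map_mul, h, map_mul, ← mul_assoc, hq]

/-- Multiplying an invariant of `I` by the cycles that start at `l` and end between two adjacent
elements `a < b` of `I ∪ {n + 1}` gives an invariant of a set with a smaller sum. -/
theorem sum_mul_cyc_mem_rightInvariants {I : Finset ℕ} (hI : I ⊆ Finset.Icc 1 (n - 1))
    {q : MonoidAlgebra k (Perm (Fin n))}
    (hq : q ∈ rightInvariants k n (nonShadow n I)) {l a b : ℕ} (h0 : 1 ≤ l) (hla : l ≤ a)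
    (hl : l ∈ I ∨ l + 1 ∈ I) (ha : a ∈ I) (hab : a < b) (hb : b ∈ I ∨ b = n + 1)
    (hgap : ∀ x ∈ I, a < x → b ≤ x) :
    ∑ j ∈ Finset.Ico a b, q * MonoidAlgebra.of k _ (cyc n l j) ∈
      rightInvariants k n (nonShadow n (lowerBetween l a I)) := by
  intro i hi
  obtain ⟨⟨hi1, hi2⟩, hi3, hi4⟩ := mem_nonShadow.1 hi
  have haI := Finset.mem_Icc.1 (hI ha)
  have hbn : b ≤ n + 1 := by
    rcases hb with hb | hb
    · have := Finset.mem_Icc.1 (hI hb)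
      omega
    · omega
  rw [Finset.sum_mul]
  rcases lt_or_ge i l with hil | hil
  -- This is where `l ∈ I ∨ l + 1 ∈ I` is needed: `s_{l-1}` does not commute past the cycles, but
  -- lowering puts `l - 1` or `l` into the new set.
  · have hil' : i + 1 ≠ l := by
      rintro rfl
      rcases hl with hl | hl
      · exact hi3 (pred_mem_lowerBetween hl le_rfl hla)
      · rcases hla.lt_or_eq with h | h
        · exact hi4 (pred_mem_lowerBetween hl (by omega) h)
        · exact hi3 (pred_mem_lowerBetween (h ▸ ha) le_rfl hla)
    refine Finset.sum_congr rfl fun j hj =>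
      mul_cyc_mul_simpleSwap (cyc_mul_simpleSwap_of_lt (by omega)) (hq i (mem_nonShadow.2
        ⟨⟨hi1, hi2⟩, fun h => hi3 (mem_lowerBetween_of_lt_or_gt h (by omega)),
        fun h => hi4 (mem_lowerBetween_of_lt_or_gt h (by omega))⟩))
  rcases lt_or_ge i a with hia | hia
  · have hia' : i + 1 ≠ a := by
      rintro rfl
      exact hi3 (pred_mem_lowerBetween ha hla le_rfl)
    refine Finset.sum_congr rfl fun j hj => ?_
    rw [Finset.mem_Ico] at hj
    refine mul_cyc_mul_simpleSwap (cyc_mul_simpleSwap_of_mem h0 hil (by omega) (by omega))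
      (hq (i + 1) (mem_nonShadow.2 ⟨by omega,
        fun h => hi3 (pred_mem_lowerBetween h (by omega) (by omega)), fun h => ?_⟩))
    rcases le_or_gt (i + 2) a with h' | h'
    · exact hi4 (pred_mem_lowerBetween h (by omega) h')
    · omega
  have hinv : a < i → q * MonoidAlgebra.of k _ (simpleSwap n i) = q := fun h =>
    hq i (mem_nonShadow.2 ⟨⟨hi1, hi2⟩, fun h => hi3 (mem_lowerBetween_of_lt_or_gt h (by omega)),
      fun h => hi4 (mem_lowerBetween_of_lt_or_gt h (by omega))⟩)
  rcases lt_or_ge i b with hib | hib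
  · have hib' : i + 1 ≠ b := by
      rintro rfl
      rcases hb with hb | hb
      · exact hi4 (mem_lowerBetween_of_lt_or_gt hb (by omega))
      · omega
    -- Right multiplication by `s_i` exchanges the summands `j = i` and `j = i + 1` and fixes every
    -- other one.
    refine Finset.sum_equiv (swap i (i + 1)) (fun j => ?_) fun j hj => ?_
    · rw [swap_apply_def]
      simp only [Finset.mem_Ico]
      split_ifs <;> omega
    · rw [Finset.mem_Ico] at hj
      rcases lt_trichotomy j i with hji | rfl | hji
      · rw [swap_apply_of_ne_of_ne (by omega) (by omega)]
        exact mul_cyc_mul_simpleSwap (cyc_mul_simpleSwap_of_gt hji) (hinv (by omega))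
      · rw [swap_apply_left, mul_assoc, ← map_mul, cyc_succ hil]
      · rcases (Nat.succ_le_of_lt hji).eq_or_lt with rfl | hji
        · rw [Nat.succ_eq_add_one, swap_apply_right, mul_assoc, ← map_mul,
            cyc_succ_mul_simpleSwap hil]
        · rw [swap_apply_of_ne_of_ne (by omega) (by omega)]
          refine mul_cyc_mul_simpleSwap
            (cyc_mul_simpleSwap_of_mem h0 hil (by omega) (by omega))
            (hq (i + 1) (mem_nonShadow.2 ⟨by omega, fun h => ?_, fun h => ?_⟩))
          · have := hgap _ h (by omega)
            omega
          · have := hgap _ h (by omega)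
            omega
  · refine Finset.sum_congr rfl fun j hj => ?_
    rw [Finset.mem_Ico] at hj
    exact mul_cyc_mul_simpleSwap (cyc_mul_simpleSwap_of_gt (by omega)) (hinv (by omega))

/-- The span of the invariants of all lacunar sets whose sum is less than `s`. -/
noncomputable def lowerInvariants (k : Type*) [CommRing k] (n s : ℕ) :
    Submodule k (MonoidAlgebra k (Perm (Fin n))) :=
  ⨆ K : {K : Finset ℕ // K ⊆ Finset.Icc 1 (n - 1) ∧ IsLacunar K ∧ ∑ x ∈ K, x < s},
    rightInvariants k n (nonShadow n K)

theorem rightInvariants_le_lowerInvariants {J : Finset ℕ} {s : ℕ} (h : ∑ x ∈ J, x < s) :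
    rightInvariants k n (nonShadow n J) ≤ lowerInvariants k n s := by
  obtain ⟨K, hK, hlac, hsum, hsub⟩ := exists_lacunar_nonShadow_subset n J
  exact (rightInvariants_anti hsub).trans
    (le_iSup (fun K : {K : Finset ℕ // K ⊆ Finset.Icc 1 (n - 1) ∧ IsLacunar K ∧
      ∑ x ∈ K, x < s} => rightInvariants k n (nonShadow n K)) ⟨K, hK, hlac, by omega⟩)

/-- Cutting the range of endpoints at the elements of `I` leaves pieces to which
`sum_mul_cyc_mem_rightInvariants` applies, each landing in the invariants of a set of smaller sum.
-/
theorem sum_mul_cyc_mem_lowerInvariants {I : Finset ℕ} (hI : I ⊆ Finset.Icc 1 (n - 1))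
    {q : MonoidAlgebra k (Perm (Fin n))}
    (hq : q ∈ rightInvariants k n (nonShadow n I)) {l : ℕ} (h0 : 1 ≤ l)
    (hl : l ∈ I ∨ l + 1 ∈ I) {a : ℕ} (hla : l ≤ a) (ha : a ∈ I ∨ a = n + 1) :
    ∑ j ∈ Finset.Ico a (n + 1), q * MonoidAlgebra.of k _ (cyc n l j) ∈
      lowerInvariants k n (∑ x ∈ I, x) := by
  induction hd : n + 1 - a using Nat.strong_induction_on generalizing a with
  | _ d ih =>
  rcases ha with ha | rfl
  · have haI := Finset.mem_Icc.1 (hI ha)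
    obtain ⟨b, hab, hb, hgap⟩ : ∃ b, a < b ∧ (b ∈ I ∨ b = n + 1) ∧ ∀ x ∈ I, a < x → b ≤ x := by
      have hex : ∃ b, a < b ∧ (b ∈ I ∨ b = n + 1) := ⟨n + 1, by omega, Or.inr rfl⟩
      classical
      exact ⟨Nat.find hex, (Nat.find_spec hex).1, (Nat.find_spec hex).2,
        fun x hx hax => Nat.find_min' hex ⟨hax, Or.inl hx⟩⟩
    have hbn : b ≤ n + 1 := by
      rcases hb with hb | hb
      · have := Finset.mem_Icc.1 (hI hb)
        omega
      · omega
    rw [← Finset.sum_Ico_consecutive _ hab.le hbn]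
    exact add_mem (rightInvariants_le_lowerInvariants (sum_lowerBetween_lt ha haI.1 hla)
      (sum_mul_cyc_mem_rightInvariants hI hq h0 hla hl ha hab hb hgap))
      (ih _ (by omega) (by omega) hb rfl)
  · simp

theorem m_spec (I : Finset ℕ) (l : Fin n) :
    ((l : ℕ) + 1 + m n I l ∈ I ∨ (l : ℕ) + 1 + m n I l = n + 1) ∧
      ∀ x ∈ I, (l : ℕ) + 1 ≤ x → (l : ℕ) + 1 + m n I l ≤ x := by
  have h1 := Finset.min'_mem _ (enclosure_filter_nonempty n I l)
  have h2 : ∀ x ∈ {x ∈ enclosure n I | (l : ℕ) + 1 ≤ x},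
      Finset.min' _ (enclosure_filter_nonempty n I l) ≤ x := fun x hx => Finset.min'_le _ x hx
  unfold m
  generalize Finset.min' _ (enclosure_filter_nonempty n I l) = p at h1 h2 ⊢
  simp only [enclosure, Finset.mem_filter, Finset.mem_union, Finset.mem_singleton] at h1 h2
  rw [Nat.add_sub_cancel' h1.2]
  refine ⟨?_, fun x hx hl => h2 x ⟨Or.inl (Or.inr hx), hl⟩⟩
  rcases h1 with ⟨(h | h) | h, h'⟩
  · omega
  · exact Or.inl h
  · exact Or.inr h

/-- On the invariants of `I`, the shuffle `t_l` acts as the scalar `m_{I,l}` modulo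
invariants of lacunar sets with smaller sums. -/
theorem mul_t_sub_mem_lowerInvariants {I : Finset ℕ} (hI : I ⊆ Finset.Icc 1 (n - 1))
    {q : MonoidAlgebra k (Perm (Fin n))}
    (hq : q ∈ rightInvariants k n (nonShadow n I)) (l : Fin n) :
    q * t k n l - (m n I l : k) • q ∈ lowerInvariants k n (∑ x ∈ I, x) := by
  obtain ⟨hp, hmin⟩ := m_spec I l
  set p := (l : ℕ) + 1 + m n I l with hpdef
  have hpn : p ≤ n + 1 := by
    rcases hp with hp | hp
    · have := Finset.mem_Icc.1 (hI hp)
      omega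
    · omega
  have hfix : ∀ j, (l : ℕ) + 1 ≤ j → j < p →
      q * MonoidAlgebra.of k _ (cyc n (l + 1) j) = q := fun j h1 h2 =>
    mul_cyc_eq_self hq (by omega) h1 (by omega) fun x hx hlx => by
      have := hmin x hx hlx
      omega
  have hsum : ∑ j ∈ Finset.Ico ((l : ℕ) + 1) p, q * MonoidAlgebra.of k _ (cyc n (l + 1) j) =
      (m n I l : k) • q := by
    rw [Finset.sum_congr rfl fun j hj => hfix j (Finset.mem_Ico.1 hj).1 (Finset.mem_Ico.1 hj).2,
      Finset.sum_const, Nat.card_Ico, hpdef, Nat.add_sub_cancel_left, Nat.cast_smul_eq_nsmul]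
  rw [t_eq_sum, Finset.mul_sum, ← Finset.sum_Ico_consecutive _ (by omega : (l : ℕ) + 1 ≤ p) hpn,
    hsum, add_sub_cancel_left]
  rcases hp with hpI | hpn'
  · rcases (by omega : (l : ℕ) + 1 ≤ p).eq_or_lt with h | h
    · exact sum_mul_cyc_mem_lowerInvariants hI hq (by omega) (Or.inl (h ▸ hpI)) h.le
        (Or.inl hpI)
    -- Since `cyc l (p-1)` fixes `q`, the start of each remaining cycle can be moved from `l` to `p
    -- - 1`, whose successor `p` lies in `I`.
    · have : ∀ j ∈ Finset.Ico p (n + 1), q * MonoidAlgebra.of k _ (cyc n (l + 1) j) =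
          q * MonoidAlgebra.of k _ (cyc n (p - 1) j) := fun j hj => by
        rw [Finset.mem_Ico] at hj
        rw [← cyc_mul_cyc (by omega : (l : ℕ) + 1 ≤ p - 1) (by omega : p - 1 ≤ j), map_mul,
          ← mul_assoc, hfix _ (by omega) (by omega)]
      rw [Finset.sum_congr rfl this]
      refine sum_mul_cyc_mem_lowerInvariants hI hq (by omega) (Or.inr ?_) (by omega)
        (Or.inl hpI)
      rwa [Nat.sub_add_cancel (by omega)]
  · rw [hpn', Finset.Ico_self, Finset.sum_empty]
    exact zero_mem _

end

/-! ### The descent-destroying basis. -/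

section

variable {n : ℕ}

/-- The permutations of `[n]` that preserve the maximal intervals whose adjacent elements `i, i + 1`
all satisfy `i ∈ D`. -/
def blockPerms (n : ℕ) (D : Finset ℕ) : Finset (Perm (Fin n)) :=
  {σ | ∀ x : Fin n, Finset.Ioc (min (x : ℕ) (σ x)) (max (x : ℕ) (σ x)) ⊆ D}

/-- Positions `x < y` of `Fin n` are numbered from `0` and adjacencies from `1`, so a move between
`x` and `y` crosses exactly the adjacencies `x + 1, …, y`. -/
theorem mem_blockPerms {D : Finset ℕ} {σ : Perm (Fin n)} :
    σ ∈ blockPerms n D ↔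
      ∀ x : Fin n, ∀ i, min (x : ℕ) (σ x) < i → i ≤ max (x : ℕ) (σ x) → i ∈ D := by
  simp only [blockPerms, Finset.mem_filter, Finset.mem_univ, true_and, Finset.subset_iff,
    Finset.mem_Ioc, and_imp]

theorem mul_simpleSwap_mem_blockPerms {D : Finset ℕ} {σ : Perm (Fin n)} (hσ : σ ∈ blockPerms n D)
    {i : ℕ} (hi : i ∈ D) : σ * simpleSwap n i ∈ blockPerms n D := by
  rw [mem_blockPerms] at hσ ⊢
  by_cases h : 1 ≤ i ∧ i < n
  · intro x j h1 h2
    have h3 := simpleSwap_apply h.1 h.2 x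
    have h4 := hσ (simpleSwap n i x) j
    rw [Perm.mul_apply] at h1 h2
    by_cases hj : j = i
    · exact hj ▸ hi
    · split_ifs at h3 <;> exact h4 (by omega) (by omega)
  · simpa [simpleSwap, h] using hσ

theorem apply_lt_of_forall_mem_Des {w : Perm (Fin n)} {x y : Fin n} (hxy : x < y)
    (h : ∀ i, (x : ℕ) < i → i ≤ y → i ∈ Des w) : w y < w x := by
  obtain ⟨y, hy⟩ := y
  have hxy' : (x : ℕ) < y := hxy
  clear hxy
  induction y, (show (x : ℕ) + 1 ≤ y from hxy') using Nat.le_induction with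
  | base =>
    obtain ⟨-, a, b, ha, hb, hab⟩ := Finset.mem_filter.1 (h _ (by omega) le_rfl)
    simp only [Nat.add_right_cancel_iff] at ha hb
    rwa [show (⟨_, hy⟩ : Fin n) = b from Fin.ext hb.symm, ← show a = x from Fin.ext ha]
  | succ y hy' ih =>
    obtain ⟨-, a, b, ha, hb, hab⟩ := Finset.mem_filter.1 (h (y + 1) (by omega) le_rfl)
    refine lt_trans ?_ (ih (by omega) (fun i h1 h2 => h i h1 (h2.trans (by simp))) hy')
    rwa [show (⟨y, by omega⟩ : Fin n) = a from Fin.ext (by simp; omega),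
      show (⟨_, hy⟩ : Fin n) = b from Fin.ext (by simp; omega)]

/-- The list of values of a permutation, to be compared lexicographically. -/
def oneLine (w : Perm (Fin n)) : Lex (Fin n → Fin n) := toLex w

theorem oneLine_injective : Function.Injective (oneLine (n := n)) :=
  fun _ _ h => DFunLike.coe_injective (toLex.injective h)

/-- The first position `x` moved by `σ` receives a value from further right in the same decreasing
run of `w`, hence a smaller one. -/
theorem oneLine_mul_lt {w σ : Perm (Fin n)} (hσ : σ ∈ blockPerms n (Des w)) (h1 : σ ≠ 1) :
    oneLine (w * σ) < oneLine w := by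
  have hex : ∃ x, σ x ≠ x := by
    by_contra! h
    exact h1 (Equiv.ext h)
  have hmin : ∀ y < Fin.find (fun x => σ x ≠ x) hex, σ y = y := fun y hy => by
    simpa using Fin.find_min hex hy
  have hx := Fin.find_spec hex
  generalize Fin.find _ hex = x at hmin hx
  have hlt : x < σ x := by
    -- If `σ x < x`, then `σ x` would be fixed by `σ`, and injectivity would give `σ x = x`.
    refine lt_of_le_of_ne (not_lt.1 fun h => hx (σ.injective (hmin _ h))) (Ne.symm hx)
  refine ⟨x, fun y hy => ?_, ?_⟩
  · change w (σ y) = w y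
    rw [hmin y hy]
  · change w (σ x) < w x
    have hlt' : (x : ℕ) < σ x := hlt
    exact apply_lt_of_forall_mem_Des hlt fun i h1 h2 =>
      mem_blockPerms.1 hσ x i (by omega) (by omega)

theorem oneLine_lt_mul_simpleSwap {w : Perm (Fin n)} {i : ℕ} (h1 : 1 ≤ i) (h2 : i < n)
    (hi : i ∉ Des w) : oneLine w < oneLine (w * simpleSwap n i) := by
  have hs : simpleSwap n i ⟨i - 1, by omega⟩ = ⟨i, h2⟩ := by
    rw [simpleSwap, dif_pos ⟨h1, h2⟩, swap_apply_left]
  refine ⟨⟨i - 1, by omega⟩, fun y hy => ?_, ?_⟩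
  · change w y = w (simpleSwap n i y)
    congr 1
    have hy' : (y : ℕ) < i - 1 := hy
    ext
    rw [simpleSwap_apply h1 h2, if_neg (by omega), if_neg (by omega)]
  · change w _ < w (simpleSwap n i _)
    rw [hs]
    refine lt_of_le_of_ne (not_lt.1 fun h => hi ?_) fun h => ?_
    · exact Finset.mem_filter.2 ⟨Finset.mem_Icc.2 (by omega), _, _, by simp; omega, rfl, h⟩
    · have := congrArg Fin.val (w.injective h)
      simp only at this
      omega

variable (k : Type*) [CommRing k]

/-- The descent-destroying element `a_w`: the sum of all `w σ`, where `σ` preserves the maximal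
decreasing runs of `w`. -/
noncomputable def descentDestroying (w : Perm (Fin n)) : MonoidAlgebra k (Perm (Fin n)) :=
  ∑ σ ∈ blockPerms n (Des w), MonoidAlgebra.of k _ (w * σ)

theorem descentDestroying_mem (w : Perm (Fin n)) :
    descentDestroying k w ∈ rightInvariants k n (Des w) := by
  intro i hi
  rw [descentDestroying, Finset.sum_mul]
  refine Finset.sum_bij' (fun σ _ => σ * simpleSwap n i) (fun σ _ => σ * simpleSwap n i)
    (fun σ hσ => mul_simpleSwap_mem_blockPerms hσ hi)
    (fun σ hσ => mul_simpleSwap_mem_blockPerms hσ hi) ?_ ?_ ?_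
  · intro σ _
    rw [mul_assoc, simpleSwap_mul_self, mul_one]
  · intro σ _
    rw [mul_assoc, simpleSwap_mul_self, mul_one]
  · intro σ _
    rw [← map_mul, mul_assoc]

theorem coeff_descentDestroying (w v : Perm (Fin n)) :
    (descentDestroying k w).coeff v = if w⁻¹ * v ∈ blockPerms n (Des w) then 1 else 0 := by
  classical
  have : ∀ σ : Perm (Fin n), (MonoidAlgebra.of k _ (w * σ)).coeff v =
      if w⁻¹ * v = σ then 1 else 0 := fun σ => by
    rw [MonoidAlgebra.of_apply, MonoidAlgebra.coeff_single, Finsupp.single_apply]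
    exact if_congr (by rw [inv_mul_eq_iff_eq_mul, eq_comm]) rfl rfl
  rw [descentDestroying, MonoidAlgebra.coeff_sum, Finsupp.finsetSum_apply]
  simp only [this, Finset.sum_ite_eq]

theorem coeff_descentDestroying_self (w : Perm (Fin n)) : (descentDestroying k w).coeff w = 1 := by
  rw [coeff_descentDestroying, if_pos]
  rw [mem_blockPerms]
  intro x i h1 h2
  simp only [inv_mul_cancel, Perm.coe_one, id_eq] at h1 h2
  omega

variable {k}

theorem oneLine_lt_of_coeff_ne_zero {w v : Perm (Fin n)} (h : (descentDestroying k w).coeff v ≠ 0)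
    (hv : v ≠ w) : oneLine v < oneLine w := by
  rw [coeff_descentDestroying] at h
  have := oneLine_mul_lt (w := w) (σ := w⁻¹ * v) (by by_contra h'; exact h (if_neg h'))
    (fun h => hv (inv_mul_eq_one.1 h).symm)
  rwa [mul_inv_cancel_left] at this

theorem coeff_mul_simpleSwap {q : MonoidAlgebra k (Perm (Fin n))} {i : ℕ}
    (hq : q * MonoidAlgebra.of k _ (simpleSwap n i) = q) (w : Perm (Fin n)) :
    q.coeff (w * simpleSwap n i) = q.coeff w := by
  conv_lhs => rw [← hq, MonoidAlgebra.of_apply]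
  rw [MonoidAlgebra.coeff_mul_single_apply, mul_inv_cancel_right, mul_one]

/-- Leading-term elimination: if `u` is the largest permutation in the support of `q`, then `D ⊆ Des
u`, since at an ascent `i ∈ D` the larger `u s_i` would have the same coefficient. Subtracting a
multiple of `a_u` keeps `q` invariant and lowers its leading term. -/
theorem rightInvariants_le_span {D : Finset ℕ} (hD : D ⊆ Finset.Icc 1 (n - 1)) :
    rightInvariants k n D ≤ Submodule.span k (descentDestroying k '' {w | D ⊆ Des w}) := by
  suffices h : ∀ w : Perm (Fin n), ∀ q ∈ rightInvariants k n D,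
      (∀ v, q.coeff v ≠ 0 → oneLine v ≤ oneLine w) →
      q ∈ Submodule.span k (descentDestroying k '' {w | D ⊆ Des w}) by
    intro q hq
    obtain ⟨w, -, hw⟩ := Finset.exists_max_image Finset.univ oneLine
      (Finset.univ_nonempty (α := Perm (Fin n)))
    exact h w q hq fun v _ => hw v (Finset.mem_univ v)
  intro w
  induction w using (InvImage.wf oneLine (wellFounded_lt (α := Lex (Fin n → Fin n)))).induction with
  | _ w ih =>
  intro q hq hw
  by_cases hq0 : q = 0
  · exact hq0 ▸ zero_mem _
  obtain ⟨u, hu, humax⟩ := Finset.exists_max_image q.coeff.support oneLine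
    (by simpa [Finsupp.support_nonempty_iff] using hq0)
  rw [Finsupp.mem_support_iff] at hu
  have hDu : D ⊆ Des u := by
    intro i hi
    by_contra hiu
    have hin := Finset.mem_Icc.1 (hD hi)
    refine (oneLine_lt_mul_simpleSwap (by omega) (by omega) hiu).not_ge (humax _ ?_)
    rwa [Finsupp.mem_support_iff, coeff_mul_simpleSwap (hq i hi)]
  have hmem : descentDestroying k u ∈
      Submodule.span k (descentDestroying k '' {w | D ⊆ Des w}) :=
    Submodule.subset_span ⟨u, hDu, rfl⟩
  set r := q - q.coeff u • descentDestroying k u with hr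
  have hrlt : ∀ v, r.coeff v ≠ 0 → oneLine v < oneLine u := by
    intro v hv
    have hrv : r.coeff v = q.coeff v - q.coeff u * (descentDestroying k u).coeff v := by
      simp [hr]
    by_cases hvu : v = u
    · subst hvu
      rw [hrv, coeff_descentDestroying_self, mul_one, sub_self] at hv
      exact absurd rfl hv
    · by_cases hc : (descentDestroying k u).coeff v = 0
      · rw [hrv, hc, mul_zero, sub_zero] at hv
        exact lt_of_le_of_ne (humax v (Finsupp.mem_support_iff.2 hv))
          fun h => hvu (oneLine_injective h)
      · exact oneLine_lt_of_coeff_ne_zero hc hvu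
  have hrmem : r ∈ Submodule.span k (descentDestroying k '' {w | D ⊆ Des w}) := by
    by_cases hr0 : r = 0
    · exact hr0 ▸ zero_mem _
    obtain ⟨v, hv, hvmax⟩ := Finset.exists_max_image r.coeff.support oneLine
      (by simpa [Finsupp.support_nonempty_iff] using hr0)
    refine ih v ((hrlt v (Finsupp.mem_support_iff.1 hv)).trans_le (hw u hu)) r ?_
      fun x hx => hvmax x (Finsupp.mem_support_iff.2 hx)
    exact sub_mem hq (Submodule.smul_mem _ _
      (rightInvariants_anti hDu (descentDestroying_mem k u)))
  rw [← sub_add_cancel q (q.coeff u • descentDestroying k u)]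
  exact add_mem hrmem (Submodule.smul_mem _ _ hmem)

theorem span_descentDestroying :
    ⊤ ≤ Submodule.span k (Set.range (descentDestroying k (n := n))) := by
  have := rightInvariants_le_span (k := k) (Finset.empty_subset (Finset.Icc 1 (n - 1)))
  simp only [Finset.empty_subset, Set.ofPred_true, Set.image_univ] at this
  exact fun q _ => this fun i hi => absurd hi (Finset.notMem_empty i)

end

/-! ### Characteristic polynomials and root multiplicities. -/

open Polynomial

theorem charpoly_of_blockTriangular_scalar {R ι α : Type*} [CommRing R] [Fintype ι]
    [DecidableEq ι] [Fintype α] [LinearOrder α] (M : Matrix ι ι R) (b : ι → α) (c : α → R)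
    (hM : ∀ i j, i ≠ j → ¬ b i < b j → M i j = 0) (hd : ∀ i, M i i = c (b i)) :
    M.charpoly = ∏ a, (X - C (c a)) ^ Fintype.card {i // b i = a} := by
  have hbt : M.BlockTriangular b := fun i j h =>
    hM i j (by rintro rfl; exact lt_irrefl _ h) h.not_gt
  have hblock : ∀ a, (M.toSquareBlock b a).charpoly =
      (X - C (c a)) ^ Fintype.card {i // b i = a} := fun a => by
    have : M.toSquareBlock b a = Matrix.diagonal fun _ => c a := by
      ext ⟨i, hi⟩ ⟨j, hj⟩
      rw [Matrix.toSquareBlock_def, Matrix.of_apply, Matrix.diagonal_apply]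
      split_ifs with h
      · cases h
        rw [hd, hi]
      · exact hM i j (fun h' => h (Subtype.ext h')) (by rw [hi, hj]; exact lt_irrefl a)
    rw [this, Matrix.charpoly_diagonal, Finset.prod_const, Finset.card_univ]
  rw [hbt.charpoly, Finset.prod_congr rfl fun a _ => hblock a]
  -- Labels not attained by `b` contribute an exponent of zero.
  refine Finset.prod_subset (Finset.subset_univ _) fun a _ ha => ?_
  have : IsEmpty {i // b i = a} :=
    ⟨fun i => ha (Finset.mem_image.2 ⟨i, Finset.mem_univ _, i.2⟩)⟩
  rw [Fintype.card_eq_zero, pow_zero]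

theorem rootMultiplicity_prod_X_sub_C_pow {k ι : Type*} [Field k] [DecidableEq k]
    (s : Finset ι) (c : ι → k) (d : ι → ℕ) (κ : k) :
    (∏ i ∈ s, (X - C (c i)) ^ d i).rootMultiplicity κ = ∑ i ∈ s with c i = κ, d i := by
  classical
  induction s using Finset.induction_on with
  | empty => simp [rootMultiplicity_eq_zero]
  | insert a s ha ih =>
    have h0 : ∀ i, (X - C (c i)) ^ d i ≠ 0 := fun i => pow_ne_zero _ (X_sub_C_ne_zero _)
    rw [Finset.prod_insert ha, rootMultiplicity_mul
      (mul_ne_zero (h0 a) (Finset.prod_ne_zero_iff.2 fun i _ => h0 i)), ih, Finset.filter_insert]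
    split_ifs with h
    · rw [Finset.sum_insert (fun h => ha (Finset.mem_filter.1 h).1), ← h,
        rootMultiplicity_X_sub_C_pow]
    · rw [rootMultiplicity_eq_zero, zero_add]
      simp only [IsRoot, eval_pow, eval_sub, eval_X, eval_C]
      exact pow_ne_zero _ (sub_ne_zero.2 (Ne.symm h))

/-! ### Triangularity with respect to the `Q`-index. -/

namespace LacunarListing

variable {k : Type*} [Field k] {n : ℕ} (L : LacunarListing n)

theorem nonShadow_Qind_subset (w : Perm (Fin n)) : nonShadow n (L.Q (L.Qind w)) ⊆ Des w :=
  (Finset.mem_filter.1 (Finset.min'_mem _ (L.exists_nonShadow_subset w))).2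

theorem Qind_le {w : Perm (Fin n)} {i : Fin (Nat.fib (n + 1))}
    (h : nonShadow n (L.Q i) ⊆ Des w) : L.Qind w ≤ i := by
  refine Finset.min'_le _ i ?_
  exact Finset.mem_filter.2 ⟨Finset.mem_univ _, h⟩

/-- The ordering of the listing enters here: a lacunar `K = Q_j` of smaller sum has `j < i`, and `K'
⊆ Des w` forces `Qind w ≤ j`. -/
theorem lowerInvariants_le_span (i : Fin (Nat.fib (n + 1))) :
    lowerInvariants k n (∑ x ∈ L.Q i, x) ≤
      Submodule.span k (descentDestroying k '' {w | L.Qind w < i}) := by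
  refine iSup_le fun ⟨K, hK, hlac, hsum⟩ => ?_
  obtain ⟨j, rfl⟩ := (L.mem_range_iff K).2 ⟨hK, hlac⟩
  refine (rightInvariants_le_span (Finset.filter_subset _ _)).trans
    (Submodule.span_mono (Set.image_mono fun w hw => (L.Qind_le hw).trans_lt ?_))
  by_contra! h
  exact absurd (L.sum_mono h) (not_le.2 hsum)

theorem R_sub_smul_mem_span (lam : Fin n → k) (w : Perm (Fin n)) :
    R (∑ l, lam l • t k n l) (descentDestroying k w) -
        L.g lam (L.Qind w) • descentDestroying k w ∈
      Submodule.span k (descentDestroying k '' {v | L.Qind v < L.Qind w}) := by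
  have hQ := (L.mem_range_iff _).1 ⟨L.Qind w, rfl⟩
  have hw : descentDestroying k w ∈ rightInvariants k n (nonShadow n (L.Q (L.Qind w))) :=
    rightInvariants_anti (L.nonShadow_Qind_subset w) (descentDestroying_mem k w)
  have : R (∑ l, lam l • t k n l) (descentDestroying k w) -
        L.g lam (L.Qind w) • descentDestroying k w =
      ∑ l, lam l • (descentDestroying k w * t k n l -
        (m n (L.Q (L.Qind w)) l : k) • descentDestroying k w) := by
    simp only [R, LinearMap.mulRight_apply, g, Finset.mul_sum, mul_smul_comm, Finset.sum_smul,
      smul_sub, Finset.sum_sub_distrib, mul_smul]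
  rw [this]
  exact Submodule.sum_mem _ fun l _ => Submodule.smul_mem _ _
    (L.lowerInvariants_le_span _ (mul_t_sub_mem_lowerInvariants hQ.1 hw l))

theorem charpoly_R (lam : Fin n → k) :
    (R (∑ l, lam l • t k n l)).charpoly = ∏ i, (X - C (L.g lam i)) ^ L.delta i := by
  have hcard : Fintype.card (Perm (Fin n)) =
      Module.finrank k (MonoidAlgebra k (Perm (Fin n))) := by
    rw [(MonoidAlgebra.coeffLinearEquiv k).finrank_eq, Module.finrank_finsupp_self]
  -- The `n!` elements `a_w` span a space of dimension `n!`, so linear independence is automatic.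
  let b := basisOfTopLeSpanOfCardEqFinrank (descentDestroying k (n := n))
    span_descentDestroying hcard
  have hb : ⇑b = descentDestroying k := coe_basisOfTopLeSpanOfCardEqFinrank _ _ _
  have key : ∀ v w, ¬ L.Qind v < L.Qind w →
      LinearMap.toMatrix b b (R (∑ l, lam l • t k n l)) v w =
        if v = w then L.g lam (L.Qind w) else 0 := by
    intro v w hvw
    have h := L.R_sub_smul_mem_span lam w
    rw [← hb, Module.Basis.mem_span_image] at h
    have h0 : b.repr (R (∑ l, lam l • t k n l) (b w) - L.g lam (L.Qind w) • b w) v = 0 := by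
      by_contra h'
      exact hvw (h (Finset.mem_coe.2 (Finsupp.mem_support_iff.2 h')))
    rw [map_sub, map_smul, Finsupp.sub_apply, Finsupp.smul_apply, b.repr_self,
      Finsupp.single_apply, sub_eq_zero] at h0
    rw [LinearMap.toMatrix_apply, h0]
    simp only [eq_comm (a := v), smul_eq_mul, mul_ite, mul_one, mul_zero]
  rw [← LinearMap.charpoly_toMatrix _ b]
  exact charpoly_of_blockTriangular_scalar _ L.Qind (L.g lam)
    (fun v w h1 h2 => by rw [key v w h2, if_neg h1])
    (fun w => by rw [key w w (lt_irrefl _), if_pos rfl])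

end LacunarListing

end OneSidedShuffle

theorem mainTheorem2 {k : Type*} [Field k] [DecidableEq k] (n : ℕ)
    (L : OneSidedShuffle.LacunarListing n) (lam : Fin n → k) (κ : k) :
    OneSidedShuffle.algMultiplicity
        (OneSidedShuffle.R (∑ l : Fin n, lam l • OneSidedShuffle.t k n l)) κ =
      ∑ i with L.g lam i = κ, L.delta i := by
  rw [OneSidedShuffle.algMultiplicity, L.charpoly_R,
    OneSidedShuffle.rootMultiplicity_prod_X_sub_C_pow]
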